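/- Identify $\mathbb{C}^4$ with $\mathbb{H}^2$ by $(z_0,z_1,z_2,z_3)\mapsto(z_0+z_1 j,\,z_2+z_3 j)$ and let $\pi:S^7\to\mathbb{C}P^3$ be the Hopf fibration. Let $g_1$ be the Fubini–Study metric on $\mathbb{C}P^3$, i.e. the metric for which $\pi$ is a Riemannian submersion from the round unit sphere. Let $\mathcal{D}_1^2$ be the image under $d\pi$ of the distribution $p\mapsto\mathrm{span}_{\mathbb{R}}\{jp,kp\}$ on $S^7$ (this is the vertical distribution of the twistor fibration $\mathbb{C}P^3\to\mathbb{H}P^1\cong S^4$), and let $\mathcal{D}_2^4$ be the image under $d\pi$ of the orthogonal complement of $\mathrm{span}_{\mathbb{R}}\{ip,jp,kp\}$ in $T_pS^7$. Let $P$ be the almost product structure equal to $-\mathrm{id}$ on $\mathcal{D}_1^2$ and to $\mathrm{id}$ on $\mathcal{D}_2^4$, and for $a>0$ put $$g_a(X,Y)=\frac{1+a}{2}\,g_1(X,Y)+\frac{a-1}{2}\,g_1(PX,Y).$$ A hypersurface of $(\mathbb{C}P^3,g_a)$ is a smooth immersion $f:M\to\mathbb{C}P^3$ of a non-empty smooth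 manifold $M$ of real dimension $5$ without boundary. If $N$ is its $g_a$-unit normal (determined up to sign at each point), the angle function $\theta_a\in[0,\pi/2]$ is given by $\cos(2\theta_a)=g_a(N,PN)$, and the hypersurface is called vertical if $\theta_a\equiv\pi/2$. For every $a>0$: 1. No hypersurface of $(\mathbb{C}P^3,g_a)$ is vertical; and no hypersurface of $(\mathbb{C}P^3,g_a)$ has its $g_a$-unit normal in $\mathcal{D}_1^2$ at every point. 2. If $U\subseteq\mathbb{C}P^3$ is open and non-empty and $N$ is a smooth $g_a$-unit vector field on $U$ with values in $\mathcal{D}_1^2$, then the $g_a$-orthogonal complement of $N$ is not an involutive distribution on $U$, i.e. there are smooth vector fields $X,Y$ on some open subset of $U$ which are $g_a$-orthogonal to $N$ and whose Lie bracket $[X,Y]$ is not. -/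

import Mathlib

open scoped Manifold ContDiff

noncomputable section

namespace TwistorCP3

/-! ### Complex projective 3-space as a smooth manifold -/

/-- The Hermitian space `ℂ⁴`. -/
abbrev C4 : Type := EuclideanSpace ℂ (Fin 4)

/-- Complex projective space `ℂP³`: the complex lines through the origin of `ℂ⁴`. -/
abbrev CP3 : Type := Projectivization ℂ C4

/-- The quotient topology of `ℂ⁴ ∖ {0}`. -/
instance : TopologicalSpace CP3 :=
  inferInstanceAs (TopologicalSpace (Quotient (projectivizationSetoid ℂ C4)))

/-- The projection `v ↦ ℂ v` of `ℂ⁴ ∖ {0}` onto `ℂP³` (with an irrelevant value at `0`).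
Its restriction to the unit sphere is the Hopf fibration `S⁷ → ℂP³`. -/
def proj (v : C4) : CP3 :=
  if h : v ≠ 0 then Projectivization.mk ℂ v h
  else Projectivization.mk ℂ (EuclideanSpace.single 0 1) (by simp)

lemma proj_of_ne {v : C4} (h : v ≠ 0) : proj v = Projectivization.mk ℂ v h := dif_pos h

lemma isOpenQuotientMap_mk' :
    IsOpenQuotientMap (Projectivization.mk' ℂ : {v : C4 // v ≠ 0} → CP3) := by
  refine ⟨fun x => ?_, continuous_quotient_mk', fun U hU => ?_⟩
  · induction x with
    | h v hv => exact ⟨⟨v, hv⟩, rfl⟩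
  · change IsOpen ((Projectivization.mk' ℂ : {v : C4 // v ≠ 0} → CP3) ⁻¹' _)
    have key : (Projectivization.mk' ℂ : {v : C4 // v ≠ 0} → CP3) ⁻¹'
        (Projectivization.mk' ℂ '' U) =
        ⋃ c : ℂˣ, (fun v : {v : C4 // v ≠ 0} =>
          (⟨(c : ℂ) • v.1, smul_ne_zero c.ne_zero v.2⟩ : {v : C4 // v ≠ 0})) ⁻¹' U := by
      ext v
      simp only [Set.mem_preimage, Set.mem_image, Set.mem_iUnion]
      constructor
      · rintro ⟨w, hw, h⟩
        obtain ⟨c, hc⟩ := (Projectivization.mk_eq_mk_iff ℂ _ _ w.2 v.2).1 h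
        refine ⟨c, ?_⟩
        convert hw
        exact hc
      · rintro ⟨c, hc⟩
        exact ⟨_, hc, (Projectivization.mk_eq_mk_iff ℂ _ _ _ v.2).2 ⟨c, rfl⟩⟩
    rw [key]
    refine isOpen_iUnion fun c => hU.preimage ?_
    exact Continuous.subtype_mk (continuous_subtype_val.const_smul (c : ℂ)) _

/-- The point `(w₀, …, 1, …)` of `ℂ⁴` with `1` in position `i` and affine coordinates `w`. -/
def affineSection (i : Fin 4) (w : Fin 3 → ℂ) : C4 :=
  WithLp.toLp 2 (i.insertNth (1 : ℂ) w)

lemma affineSection_ne (i : Fin 4) (w : Fin 3 → ℂ) : affineSection i w ≠ 0 := by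
  intro h
  have := congrArg (fun v : C4 => v i) h
  simp [affineSection] at this

lemma continuous_affineSection (i : Fin 4) : Continuous (affineSection i) :=
  (PiLp.continuous_toLp 2 _).comp (continuous_const.finInsertNth i continuous_id)

/-- The standard affine chart `[z] ↦ (z_j / z_i)_{j ≠ i}` on `{z_i ≠ 0}`. -/
def affineChart (i : Fin 4) : OpenPartialHomeomorph CP3 (Fin 3 → ℂ) where
  toFun := Projectivization.lift
    (fun v : {v : C4 // v ≠ 0} => fun j => v.1 (i.succAbove j) / v.1 i) (by
      rintro ⟨a, ha⟩ ⟨b, hb⟩ t (rfl : a = t • b)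
      have ht : t ≠ 0 := by rintro rfl; simp at ha
      funext j
      simp [mul_div_mul_left _ _ ht])
  invFun w := Projectivization.mk ℂ (affineSection i w) (affineSection_ne i w)
  source := {x | Projectivization.lift (fun v : {v : C4 // v ≠ 0} => v.1 i ≠ 0) (by
    rintro ⟨a, ha⟩ ⟨b, hb⟩ t (rfl : a = t • b)
    have ht : t ≠ 0 := by rintro rfl; simp at ha
    simp [ht]) x}
  target := Set.univ
  map_source' _ _ := Set.mem_univ _
  map_target' w _ := by
    change affineSection i w i ≠ 0
    simp [affineSection]
  left_inv' x hx := by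
    obtain ⟨⟨v, hv⟩, rfl⟩ := isOpenQuotientMap_mk'.surjective x
    change v i ≠ 0 at hx
    refine (Projectivization.mk_eq_mk_iff' ℂ _ _ _ _).2 ⟨(v i)⁻¹, ?_⟩
    ext k
    refine Fin.succAboveCases i ?_ (fun j => ?_) k
    · simp [affineSection, hx]
    · simp [affineSection, div_eq_inv_mul]
  right_inv' w _ := by
    funext j
    simp [affineSection]
  open_source := by
    refine isOpenQuotientMap_mk'.isQuotientMap.isOpen_preimage.1 ?_
    change IsOpen {v : {v : C4 // v ≠ 0} | v.1 i ≠ 0}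
    exact isOpen_ne_fun (by fun_prop) continuous_const
  open_target := isOpen_univ
  continuousOn_toFun := by
    have ho : IsOpen {v : {v : C4 // v ≠ 0} | v.1 i ≠ 0} :=
      isOpen_ne_fun (by fun_prop) continuous_const
    refine (isOpenQuotientMap_mk'.isQuotientMap.continuousOn_isOpen_iff
      (isOpenQuotientMap_mk'.isQuotientMap.isOpen_preimage.1 (by exact ho))).2 ?_
    change ContinuousOn (fun v : {v : C4 // v ≠ 0} => fun j : Fin 3 =>
      v.1 (i.succAbove j) / v.1 i) {v | v.1 i ≠ 0}
    refine continuousOn_pi.2 fun j => ContinuousOn.div ?_ ?_ fun v hv => hv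
    · exact Continuous.continuousOn (by fun_prop)
    · exact Continuous.continuousOn (by fun_prop)
  continuousOn_invFun :=
    (isOpenQuotientMap_mk'.continuous.comp
      ((continuous_affineSection i).subtype_mk (affineSection_ne i))).continuousOn

lemma mem_affineChart_source {i : Fin 4} {v : C4} (hv : v ≠ 0) :
    proj v ∈ (affineChart i).source ↔ v i ≠ 0 := by
  rw [proj_of_ne hv]; rfl

lemma affineChart_proj (i : Fin 4) {v : C4} (hv : v ≠ 0) (j : Fin 3) :
    affineChart i (proj v) j = v (i.succAbove j) / v i := by
  rw [proj_of_ne hv]; rfl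

lemma affineChart_symm (i : Fin 4) (w : Fin 3 → ℂ) :
    (affineChart i).symm w = proj (affineSection i w) :=
  (proj_of_ne (affineSection_ne i w)).symm

/-- A unit vector spanning the line `x`: a point of `S⁷` in the Hopf fibre over `x`. -/
def unitRep (x : CP3) : C4 := (‖x.rep‖⁻¹ : ℂ) • x.rep

lemma norm_unitRep (x : CP3) : ‖unitRep x‖ = 1 := by
  have := norm_ne_zero_iff.2 x.rep_nonzero
  simp [unitRep, norm_smul, this]

lemma unitRep_ne (x : CP3) : unitRep x ≠ 0 := by
  rw [← norm_ne_zero_iff, norm_unitRep]; exact one_ne_zero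

lemma proj_unitRep (x : CP3) : proj (unitRep x) = x := by
  rw [proj_of_ne (unitRep_ne x)]
  conv_rhs => rw [← x.mk_rep]
  exact (Projectivization.mk_eq_mk_iff' ℂ _ _ _ _).2 ⟨_, rfl⟩

lemma exists_mem_affineChart_source (x : CP3) : ∃ i, x ∈ (affineChart i).source := by
  rw [← proj_unitRep x]
  by_contra! h
  refine unitRep_ne x ?_
  ext i
  have := h i
  rw [mem_affineChart_source (unitRep_ne x)] at this
  simpa using this

/-- The index of the preferred affine chart around `x`. -/
def chartIndex (x : CP3) : Fin 4 := (exists_mem_affineChart_source x).choose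

lemma mem_chartIndex_source (x : CP3) : x ∈ (affineChart (chartIndex x)).source :=
  (exists_mem_affineChart_source x).choose_spec

instance : ChartedSpace (Fin 3 → ℂ) CP3 where
  atlas := Set.range affineChart
  chartAt x := affineChart (chartIndex x)
  mem_chart_source x := mem_chartIndex_source x
  chart_mem_atlas _ := ⟨_, rfl⟩

lemma contDiff_affineSection (i : Fin 4) (k : Fin 4) :
    ContDiff ℝ ∞ (fun w : Fin 3 → ℂ => affineSection i w k) := by
  refine Fin.succAboveCases i ?_ (fun j => ?_) k
  · simp only [affineSection, Fin.insertNth_apply_same]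
    exact contDiff_const
  · simp only [affineSection, Fin.insertNth_apply_succAbove]
    exact contDiff_apply ℝ ℂ j

/-- `ℂP³` as a smooth real manifold, modelled on `ℂ³` as a real vector space. -/
instance : IsManifold 𝓘(ℝ, Fin 3 → ℂ) ∞ CP3 := by
  refine isManifold_of_contDiffOn _ _ _ ?_
  rintro _ _ ⟨i, rfl⟩ ⟨j, rfl⟩
  simp only [modelWithCornersSelf_coe, modelWithCornersSelf_coe_symm, Function.comp_id,
    Function.id_comp, Set.preimage_id, Set.range_id, Set.inter_univ]
  refine contDiffOn_pi.2 fun k => ?_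
  have h : ∀ w ∈ ((affineChart i).symm.trans (affineChart j)).source,
      affineSection i w j ≠ 0 := by
    intro w hw
    rw [OpenPartialHomeomorph.trans_source] at hw
    have := hw.2
    rw [Set.mem_preimage, affineChart_symm, mem_affineChart_source (affineSection_ne i w)] at this
    exact this
  refine ContDiffOn.congr (f := fun w => affineSection i w (j.succAbove k) * (affineSection i w j)⁻¹)
    ((contDiff_affineSection i _).contDiffOn.mul ((contDiff_affineSection i j).contDiffOn.inv h)) ?_
  intro w _
  rw [OpenPartialHomeomorph.coe_trans, Function.comp_apply, affineChart_symm,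
    affineChart_proj _ (affineSection_ne i w), div_eq_mul_inv]

/-- The real tangent space `T_x ℂP³`. -/
abbrev TCP3 (x : CP3) : Type := TangentSpace 𝓘(ℝ, Fin 3 → ℂ) x

/-! ### The Hopf fibration and the Fubini–Study metric -/

/-- The differential `dπ_p : ℂ⁴ → T_{π(p)} ℂP³` of the projection at a point `p ≠ 0`. For `|p| = 1`
its restriction to `T_p S⁷ = {p}^⊥` is the differential of the Hopf fibration. -/
def dproj (p : C4) : C4 →L[ℝ] TCP3 (proj p) :=
  mfderiv 𝓘(ℝ, C4) 𝓘(ℝ, Fin 3 → ℂ) proj p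

/-- The horizontal space of the Hopf fibration at `p ∈ S⁷`: the real orthogonal complement of
`p` and `i p`. -/
def horizontal (p : C4) : Submodule ℝ C4 :=
  (Submodule.span ℝ {p, Complex.I • p})ᗮ

lemma inner_real_eq (v w : C4) : inner ℝ v w = (inner ℂ v w).re := by
  simp [PiLp.inner_apply]

lemma mem_horizontal {p w : C4} : w ∈ horizontal p ↔ inner ℂ p w = 0 := by
  simp only [horizontal, Submodule.mem_orthogonal, Submodule.mem_span_pair]
  constructor
  · intro h
    have h1 := h p ⟨1, 0, by simp⟩
    have h2 := h (Complex.I • p) ⟨0, 1, by simp⟩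
    rw [inner_real_eq] at h1 h2
    rw [inner_smul_left] at h2
    apply Complex.ext
    · simpa using h1
    · simpa using h2
  · rintro h _ ⟨a, b, rfl⟩
    have h2 : inner ℂ (Complex.I • p) w = 0 := by rw [inner_smul_left, h, mul_zero]
    rw [inner_add_left, real_inner_smul_left, real_inner_smul_left, inner_real_eq, inner_real_eq,
      h, h2]
    simp

lemma hasFDerivAt_quotients (i : Fin 4) {p : C4} (hi : p i ≠ 0) :
    HasFDerivAt (fun v : C4 => fun j : Fin 3 => v (i.succAbove j) / v i)
      (ContinuousLinearMap.pi fun j : Fin 3 =>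
        ((p i)⁻¹ • (EuclideanSpace.proj (i.succAbove j) : C4 →L[ℂ] ℂ) -
          (p (i.succAbove j) / p i ^ 2) •
            (EuclideanSpace.proj i : C4 →L[ℂ] ℂ)).restrictScalars ℝ) p := by
  refine hasFDerivAt_pi.2 fun j => ?_
  have h1 : HasFDerivAt (fun v : C4 => v (i.succAbove j))
    (EuclideanSpace.proj (i.succAbove j) : C4 →L[ℂ] ℂ) p :=
    (EuclideanSpace.proj (i.succAbove j) : C4 →L[ℂ] ℂ).hasFDerivAt
  have h2 : HasFDerivAt (fun v : C4 => v i) (EuclideanSpace.proj i : C4 →L[ℂ] ℂ) p :=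
    (EuclideanSpace.proj i : C4 →L[ℂ] ℂ).hasFDerivAt
  refine HasFDerivAt.restrictScalars ℝ ?_
  simp only [div_eq_mul_inv]
  refine (h1.mul ((hasDerivAt_inv hi).comp_hasFDerivAt p h2)).congr_fderiv ?_
  ext w
  simp
  ring

lemma eventually_ne_of_ne {p : C4} {i : Fin 4} (hi : p i ≠ 0) :
    ∀ᶠ v : C4 in nhds p, v i ≠ 0 :=
  (isOpen_ne_fun (f := fun v : C4 => v i) (by fun_prop) continuous_const).mem_nhds hi

lemma ne_of_coord_ne {v : C4} {i : Fin 4} (hi : v i ≠ 0) : v ≠ 0 := by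
  rintro rfl; simp at hi

lemma continuousAt_proj {p : C4} (hp : p ≠ 0) : ContinuousAt proj p := by
  have : ContinuousOn proj {v : C4 | v ≠ 0} := by
    rw [continuousOn_iff_continuous_domRestrict]
    have h : Set.domRestrict {v : C4 | v ≠ 0} proj =
        (Projectivization.mk' ℂ : {v : C4 // v ≠ 0} → CP3) := funext fun v => proj_of_ne v.2
    rw [h]
    exact isOpenQuotientMap_mk'.continuous
  exact this.continuousAt (isOpen_ne.mem_nhds hp)

/-- The differential of the projection in the preferred chart. -/
lemma hasMFDerivAt_proj {p : C4} (hp : p ≠ 0) :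
    HasMFDerivAt 𝓘(ℝ, C4) 𝓘(ℝ, Fin 3 → ℂ) proj p
      (ContinuousLinearMap.pi fun j : Fin 3 =>
        ((p (chartIndex (proj p)))⁻¹ •
            (EuclideanSpace.proj ((chartIndex (proj p)).succAbove j) : C4 →L[ℂ] ℂ) -
          (p ((chartIndex (proj p)).succAbove j) / p (chartIndex (proj p)) ^ 2) •
            (EuclideanSpace.proj (chartIndex (proj p)) : C4 →L[ℂ] ℂ)).restrictScalars ℝ) := by
  have hi : p (chartIndex (proj p)) ≠ 0 :=
    (mem_affineChart_source hp).1 (mem_chartIndex_source _)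
  refine ⟨continuousAt_proj hp, ?_⟩
  refine HasFDerivAt.hasFDerivWithinAt ?_
  refine (hasFDerivAt_quotients _ hi).congr_of_eventuallyEq ?_
  refine (eventually_ne_of_ne hi).mono fun v hv => ?_
  funext j
  exact affineChart_proj _ (ne_of_coord_ne hv) j

lemma dproj_apply {p : C4} (hp : p ≠ 0) (w : C4) (j : Fin 3) :
    (dproj p w : Fin 3 → ℂ) j = (p (chartIndex (proj p)))⁻¹ *
        w ((chartIndex (proj p)).succAbove j) -
      (p ((chartIndex (proj p)).succAbove j) / p (chartIndex (proj p)) ^ 2) *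
        w (chartIndex (proj p)) := by
  rw [dproj, (hasMFDerivAt_proj hp).mfderiv]
  rfl

lemma dproj_bijective {p : C4} (hp : p ≠ 0) :
    Function.Bijective ((dproj p : C4 →ₗ[ℝ] TCP3 (proj p)).domRestrict (horizontal p)) := by
  have hi : p (chartIndex (proj p)) ≠ 0 :=
    (mem_affineChart_source hp).1 (mem_chartIndex_source _)
  have hpp : inner ℂ p p ≠ 0 := inner_self_ne_zero.2 hp
  constructor
  · rw [← LinearMap.ker_eq_bot, LinearMap.ker_eq_bot']
    rintro ⟨w, hw⟩ h
    have h' : ∀ j, (dproj p w : Fin 3 → ℂ) j = 0 := fun j => congrFun h j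
    have hwp : w = (w (chartIndex (proj p)) / p (chartIndex (proj p))) • p := by
      ext k
      refine Fin.succAboveCases (chartIndex (proj p)) ?_ (fun j => ?_) k
      · simp [hi]
      · have := h' j
        rw [dproj_apply hp] at this
        simp only [PiLp.smul_apply, smul_eq_mul]
        field_simp at this ⊢
        linear_combination this
    rw [mem_horizontal, hwp, inner_smul_right, mul_eq_zero, or_iff_left hpp] at hw
    rw [hw, zero_smul] at hwp
    exact Subtype.ext hwp
  · intro u
    let w₀ : C4 := WithLp.toLp 2
      ((chartIndex (proj p)).insertNth (0 : ℂ)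
        (fun j => p (chartIndex (proj p)) * (u : Fin 3 → ℂ) j))
    refine ⟨⟨w₀ - (inner ℂ p w₀ / inner ℂ p p) • p, ?_⟩, ?_⟩
    · rw [mem_horizontal, inner_sub_right, inner_smul_right, div_mul_cancel₀ _ hpp, sub_self]
    · funext j
      change (dproj p (w₀ - (inner ℂ p w₀ / inner ℂ p p) • p) : Fin 3 → ℂ) j = u j
      rw [dproj_apply hp]
      simp only [PiLp.sub_apply, PiLp.smul_apply, smul_eq_mul, w₀, Fin.insertNth_apply_same,
        Fin.insertNth_apply_succAbove]
      field_simp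
      ring

/-- The differential of the Hopf fibration at the unit representative of `x`, with values in
`T_x ℂP³` (the base point `π (unitRep x)` equals `x`). -/
def dHopf (x : CP3) : C4 →ₗ[ℝ] TCP3 x := (dproj (unitRep x) : C4 →ₗ[ℝ] TCP3 (proj (unitRep x)))

/-- The horizontal lift `T_x ℂP³ ≃ (p, i p)^⊥`, inverse to the differential of the Hopf fibration,
at the unit representative `p` of `x`. -/
def horLift (x : CP3) : TCP3 x ≃ₗ[ℝ] horizontal (unitRep x) :=
  (LinearEquiv.ofBijective ((dHopf x).domRestrict (horizontal (unitRep x)))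
    (dproj_bijective (unitRep_ne x))).symm

/-- The Fubini–Study metric `g₁`: the metric for which the Hopf fibration `S⁷ → ℂP³` is a
Riemannian submersion. -/
def fubiniStudy (x : CP3) (u v : TCP3 x) : ℝ :=
  inner ℝ (horLift x u : C4) (horLift x v : C4)

/-! ### The twistor-fibre distribution and the metrics `g_a` -/

/-- Left multiplication by `j` on `ℍ² = ℂ⁴`, where `(z₀, z₁, z₂, z₃)` is identified with
`(z₀ + z₁ j, z₂ + z₃ j)`. -/
def jMul (p : C4) : C4 :=
  !₂[-(starRingEnd ℂ) (p 1), (starRingEnd ℂ) (p 0), -(starRingEnd ℂ) (p 3), (starRingEnd ℂ) (p 2)]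

/-- Left multiplication by `k = i j`. -/
def kMul (p : C4) : C4 := Complex.I • jMul p

/-- The distribution `span {j p, k p}` on `S⁷`. -/
def liftD1 (p : C4) : Submodule ℝ C4 := Submodule.span ℝ {jMul p, kMul p}

/-- The distribution on `S⁷` orthogonal to `i p`, `j p` and `k p`. -/
def liftD2 (p : C4) : Submodule ℝ C4 :=
  (Submodule.span ℝ {p, Complex.I • p, jMul p, kMul p})ᗮ

/-- The vertical distribution `D₁²` of the twistor fibration `ℂP³ → ℍP¹ = S⁴`. -/
def D1 (x : CP3) : Submodule ℝ (TCP3 x) := (liftD1 (unitRep x)).map (dHopf x)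

/-- The horizontal distribution `D₂⁴` of the twistor fibration. -/
def D2 (x : CP3) : Submodule ℝ (TCP3 x) := (liftD2 (unitRep x)).map (dHopf x)

/-- The almost product structure `P`, equal to `-1` on `D₁²` and to `1` on `D₂⁴`: the horizontal
lift is reflected in the orthogonal complement of `span {j p, k p}`. -/
def almostProduct (x : CP3) : TCP3 x →ₗ[ℝ] TCP3 x :=
  dHopf x ∘ₗ ((liftD1 (unitRep x))ᗮ.reflection.toLinearEquiv : C4 →ₗ[ℝ] C4) ∘ₗ
    (horizontal (unitRep x)).subtype ∘ₗ (horLift x : TCP3 x →ₗ[ℝ] horizontal (unitRep x))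

/-- The homogeneous metric `g_a = (1 + a) / 2 · g₁ + (a - 1) / 2 · g₁(P ·, ·)`. -/
def metric (a : ℝ) (x : CP3) (u v : TCP3 x) : ℝ :=
  (1 + a) / 2 * fubiniStudy x u v + (a - 1) / 2 * fubiniStudy x (almostProduct x u) v

/-! ### Independence of the chosen unit representative -/

/-- The quaternion `z + w j`. -/
def toQuaternion (z w : ℂ) : Quaternion ℝ := ⟨z.re, z.im, w.re, w.im⟩

/-- `jMul` is left multiplication by the quaternion `j` in both components of `ℍ²`. -/
lemma jMul_eq_quaternion (p : C4) :
    toQuaternion (jMul p 0) (jMul p 1) =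
      toQuaternion 0 1 * toQuaternion (p 0) (p 1) ∧
    toQuaternion (jMul p 2) (jMul p 3) =
      toQuaternion 0 1 * toQuaternion (p 2) (p 3) := by
  constructor <;> ext <;>
    simp only [Quaternion.re_mul, Quaternion.imI_mul, Quaternion.imJ_mul, Quaternion.imK_mul] <;>
    simp [toQuaternion, jMul]

lemma exists_unitRep_eq {p : C4} (hp : ‖p‖ = 1) :
    ∃ c : ℂ, ‖c‖ = 1 ∧ unitRep (proj p) = c • p := by
  have hp0 : p ≠ 0 := by rw [← norm_ne_zero_iff, hp]; exact one_ne_zero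
  have h := proj_unitRep (proj p)
  rw [proj_of_ne (unitRep_ne _), proj_of_ne hp0] at h
  obtain ⟨c, hc⟩ := (Projectivization.mk_eq_mk_iff' ℂ _ _ _ _).1 h
  rw [← proj_of_ne hp0] at hc
  refine ⟨c, ?_, hc.symm⟩
  have := congrArg norm hc
  rwa [norm_smul, hp, mul_one, norm_unitRep] at this

lemma dHopf_smul {p : C4} (hp : p ≠ 0) {c : ℂ} (hc : c ≠ 0) (h : unitRep (proj p) = c • p)
    (w : C4) : dHopf (proj p) (c • w) = dproj p w := by
  funext j
  refine (dproj_apply (unitRep_ne (proj p)) (c • w) j).trans ?_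
  rw [proj_unitRep, h, dproj_apply hp]
  have hi : p (chartIndex (proj p)) ≠ 0 :=
    (mem_affineChart_source hp).1 (mem_chartIndex_source _)
  simp only [PiLp.smul_apply, smul_eq_mul]
  field_simp

lemma dHopf_horLift (x : CP3) (u : TCP3 x) : dHopf x (horLift x u : C4) = u :=
  (horLift x).symm_apply_apply u

lemma horLift_dHopf (x : CP3) {w : C4} (hw : w ∈ horizontal (unitRep x)) :
    (horLift x (dHopf x w) : C4) = w :=
  congrArg Subtype.val ((horLift x).apply_symm_apply ⟨w, hw⟩)

lemma horLift_dproj {p : C4} (hp : p ≠ 0) {c : ℂ} (hc : c ≠ 0) (h : unitRep (proj p) = c • p)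
    {w : C4} (hw : w ∈ horizontal p) : (horLift (proj p) (dproj p w) : C4) = c • w := by
  rw [← dHopf_smul hp hc h, horLift_dHopf]
  rw [mem_horizontal] at hw ⊢
  rw [h, inner_smul_left, inner_smul_right, hw, mul_zero, mul_zero]

/-- The Hopf fibration is a Riemannian submersion onto `ℂP³` with the metric `g₁`. -/
lemma fubiniStudy_dproj {p : C4} (hp : ‖p‖ = 1) {v w : C4} (hv : v ∈ horizontal p)
    (hw : w ∈ horizontal p) :
    fubiniStudy (proj p) (dproj p v) (dproj p w) = inner ℝ v w := by
  have hp0 : p ≠ 0 := by rw [← norm_ne_zero_iff, hp]; exact one_ne_zero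
  obtain ⟨c, hc, h⟩ := exists_unitRep_eq hp
  have hc0 : c ≠ 0 := by rw [← norm_ne_zero_iff, hc]; exact one_ne_zero
  rw [fubiniStudy, horLift_dproj hp0 hc0 h hv, horLift_dproj hp0 hc0 h hw, inner_real_eq,
    inner_real_eq, inner_smul_left, inner_smul_right, ← mul_assoc, ← Complex.normSq_eq_conj_mul_self,
    Complex.normSq_eq_norm_sq, hc]
  simp

lemma jMul_smul (c : ℂ) (p : C4) : jMul (c • p) = (starRingEnd ℂ) c • jMul p := by
  ext k
  fin_cases k <;> simp [jMul]

lemma mem_liftD1 {p w : C4} : w ∈ liftD1 p ↔ ∃ z : ℂ, w = z • jMul p := by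
  simp only [liftD1, Submodule.mem_span_pair, kMul]
  constructor
  · rintro ⟨a, b, rfl⟩
    refine ⟨a + b * Complex.I, ?_⟩
    rw [add_smul, mul_smul]
    rfl
  · rintro ⟨z, rfl⟩
    refine ⟨z.re, z.im, ?_⟩
    conv_rhs => rw [← Complex.re_add_im z, add_smul, mul_smul]
    rfl

lemma mem_liftD2 {p w : C4} : w ∈ liftD2 p ↔ inner ℂ p w = 0 ∧ inner ℂ (jMul p) w = 0 := by
  rw [← mem_horizontal, ← mem_horizontal, horizontal, horizontal, ← Submodule.mem_inf,
    Submodule.inf_orthogonal, ← Submodule.span_union, liftD2, kMul]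
  have : ({p, Complex.I • p} ∪ {jMul p, Complex.I • jMul p} : Set C4) =
      {p, Complex.I • p, jMul p, Complex.I • jMul p} := by
    rw [Set.insert_union, Set.singleton_union]
  rw [this]

lemma inner_jMul (p : C4) : inner ℂ p (jMul p) = 0 := by
  simp [PiLp.inner_apply, Fin.sum_univ_four, jMul]
  ring

lemma liftD1_le_horizontal (p : C4) : liftD1 p ≤ horizontal p := by
  intro w hw
  obtain ⟨z, rfl⟩ := mem_liftD1.1 hw
  rw [mem_horizontal, inner_smul_right, inner_jMul, mul_zero]

/-- `D₁²` is the image of `span {j p, k p}` for every `p` in the Hopf fibre. -/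
lemma D1_proj {p : C4} (hp : ‖p‖ = 1) :
    D1 (proj p) = (liftD1 p).map (dproj p : C4 →ₗ[ℝ] TCP3 (proj p)) := by
  have hp0 : p ≠ 0 := by rw [← norm_ne_zero_iff, hp]; exact one_ne_zero
  obtain ⟨c, hc, h⟩ := exists_unitRep_eq hp
  have hc0 : c ≠ 0 := by rw [← norm_ne_zero_iff, hc]; exact one_ne_zero
  have hc1 : (starRingEnd ℂ) c ≠ 0 := by simpa using hc0
  ext u
  simp only [D1, Submodule.mem_map, mem_liftD1, h, jMul_smul]
  constructor
  · rintro ⟨_, ⟨z, rfl⟩, rfl⟩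
    refine ⟨_, ⟨c⁻¹ * z * (starRingEnd ℂ) c, rfl⟩, ?_⟩
    refine (dHopf_smul hp0 hc0 h _).symm.trans ?_
    rw [smul_smul, smul_smul]
    congr 2
    field_simp
  · rintro ⟨_, ⟨z, rfl⟩, rfl⟩
    refine ⟨_, ⟨c * z * ((starRingEnd ℂ) c)⁻¹, rfl⟩, ?_⟩
    refine Eq.trans ?_ (dHopf_smul hp0 hc0 h _)
    rw [smul_smul, smul_smul]
    congr 2
    field_simp

/-- `D₂⁴` is the image of `(p, i p, j p, k p)^⊥` for every `p` in the Hopf fibre. -/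
lemma D2_proj {p : C4} (hp : ‖p‖ = 1) :
    D2 (proj p) = (liftD2 p).map (dproj p : C4 →ₗ[ℝ] TCP3 (proj p)) := by
  have hp0 : p ≠ 0 := by rw [← norm_ne_zero_iff, hp]; exact one_ne_zero
  obtain ⟨c, hc, h⟩ := exists_unitRep_eq hp
  have hc0 : c ≠ 0 := by rw [← norm_ne_zero_iff, hc]; exact one_ne_zero
  have hc1 : (starRingEnd ℂ) c ≠ 0 := by simpa using hc0
  ext u
  simp only [D2, Submodule.mem_map, mem_liftD2, h, jMul_smul, inner_smul_left, mul_eq_zero, hc1,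
    false_or, Complex.conj_conj, hc0]
  constructor
  · rintro ⟨w, hw, rfl⟩
    refine ⟨c⁻¹ • w, by simp [hw], ?_⟩
    refine (dHopf_smul hp0 hc0 h _).symm.trans ?_
    rw [smul_inv_smul₀ hc0]
  · rintro ⟨w, hw, rfl⟩
    exact ⟨c • w, by simp [inner_smul_right, hw], dHopf_smul hp0 hc0 h _⟩

lemma almostProduct_of_mem_D1 {x : CP3} {u : TCP3 x} (hu : u ∈ D1 x) : almostProduct x u = -u := by
  obtain ⟨w, hw, rfl⟩ := hu
  change dHopf x ((liftD1 (unitRep x))ᗮ.reflection (horLift x (dHopf x w) : C4)) = _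
  rw [horLift_dHopf x (liftD1_le_horizontal _ hw), Submodule.reflection_orthogonal_apply,
    Submodule.reflection_mem_subspace_eq_self hw, map_neg]

lemma almostProduct_of_mem_D2 {x : CP3} {u : TCP3 x} (hu : u ∈ D2 x) : almostProduct x u = u := by
  obtain ⟨w, hw, rfl⟩ := hu
  change dHopf x ((liftD1 (unitRep x))ᗮ.reflection (horLift x (dHopf x w) : C4)) = _
  have h1 : w ∈ horizontal (unitRep x) :=
    Submodule.orthogonal_le (Submodule.span_mono (by intro; simp; tauto)) hw
  have h2 : w ∈ (liftD1 (unitRep x))ᗮ :=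
    Submodule.orthogonal_le (Submodule.span_mono (by intro; simp; tauto)) hw
  rw [horLift_dHopf x h1, Submodule.reflection_mem_subspace_eq_self h2]

/-! ### Hypersurfaces -/

section Hypersurface

variable {M : Type*} [TopologicalSpace M] [ChartedSpace (EuclideanSpace ℝ (Fin 5)) M]

/-- A hypersurface of `ℂP³`: a smooth immersion of a manifold of real dimension `5`. -/
def IsHypersurface (f : M → CP3) : Prop :=
  ContMDiff (𝓡 5) 𝓘(ℝ, Fin 3 → ℂ) ∞ f ∧
    ∀ m : M, Function.Injective (mfderiv (𝓡 5) 𝓘(ℝ, Fin 3 → ℂ) f m)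

/-- `N` is a unit normal vector of the hypersurface `f` at `m`, for the metric `g_a`. -/
def IsUnitNormal (a : ℝ) (f : M → CP3) (m : M) (N : TCP3 (f m)) : Prop :=
  metric a (f m) N N = 1 ∧
    ∀ v : TangentSpace (𝓡 5) m, metric a (f m) N (mfderiv (𝓡 5) 𝓘(ℝ, Fin 3 → ℂ) f m v) = 0

/-- The angle `θ_a ∈ [0, π/2]` with `cos (2 θ_a) = g_a(N, P N)`, for a `g_a`-unit vector `N`. -/
def angle (a : ℝ) (x : CP3) (N : TCP3 x) : ℝ :=
  Real.arccos (metric a x N (almostProduct x N)) / 2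

/-- The hypersurface is vertical in `(ℂP³, g_a)`: the angle function of its unit normal is
identically `π/2`. The unit normal is unique up to sign at each point and the angle does not depend
on the sign, so no continuity is asked for. -/
def IsVertical (a : ℝ) (f : M → CP3) : Prop :=
  ∃ N : ∀ m : M, TCP3 (f m), ∀ m, IsUnitNormal a f m (N m) ∧ angle a (f m) (N m) = Real.pi / 2

end Hypersurface

/-! ### Distributions -/

/-- `X` is a smooth vector field on the open set `U`. -/
def IsSmoothFieldOn (X : ∀ x : CP3, TCP3 x) (U : Set CP3) : Prop :=
  ContMDiffOn 𝓘(ℝ, Fin 3 → ℂ) (𝓘(ℝ, Fin 3 → ℂ)).tangent ∞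
    (fun x => (⟨x, X x⟩ : TangentBundle 𝓘(ℝ, Fin 3 → ℂ) CP3)) U

/-- The distribution `D` is involutive on `U`: brackets of local sections over open subsets of `U`
are again sections. -/
def IsInvolutiveOn (D : ∀ x : CP3, Set (TCP3 x)) (U : Set CP3) : Prop :=
  ∀ V ⊆ U, IsOpen V → ∀ X Y : ∀ x : CP3, TCP3 x, IsSmoothFieldOn X V → IsSmoothFieldOn Y V →
    (∀ x ∈ V, X x ∈ D x) → (∀ x ∈ V, Y x ∈ D x) →
    ∀ x ∈ V, VectorField.mlieBracket 𝓘(ℝ, Fin 3 → ℂ) X Y x ∈ D x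

/-- The `g_a`-orthogonal complement of the vector field `N`. -/
def orthogonalDistribution (a : ℝ) (N : ∀ x : CP3, TCP3 x) (x : CP3) : Set (TCP3 x) :=
  {u | metric a x u (N x) = 0}

end TwistorCP3

end

open TwistorCP3

/-! Write `ω` for the form `symplectic`. Since `⟨j p, w⟩ = ω(p, w)`, pairing a non-zero `N ∈ D₁²`
with `dπ_p w` under `g_a` gives `Re (z̄ ω(p, w))` for some `z ≠ 0` (`exists_metric_eq_symplectic`).
The geometry is thus governed by the complex contact form `α = ω(p, ·)`, whose kernel is `D₂⁴`. The
parameter `a` drops out, and `a > 0` serves only to show that angle `π/2` forces `N ∈ D₁²`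
(`mem_D1_of_angle_eq`).

Hypersurfaces: if the normal lies in `D₁²` everywhere, then `α`, pulled back along a local lift to
`ℂ⁴`, takes values in one real line of `ℂ` at each point. Differentiating this condition and
antisymmetrizing shows that `ω` takes values in the same line on the kernel of `α`
(`im_conj_mul_eq_zero_of_line_valued`). But the tangent space is all of `N^⊥`, so it contains `D₂⁴`,
a complex subspace on which `ω` is complex bilinear and non-zero (`exists_symplectic_ne_zero`). The
values of `ω` therefore fill `ℂ`, a contradiction.

Distributions: `N^⊥` contains `D₂⁴`. On `{z₀ ≠ 0}` there are sections of `D₂⁴` whose bracket is `-2c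
∂₁`, with `c ∈ ℂ` arbitrary and `α(∂₁) = 1` (`lieBracket_contactField`). Involutivity would give `Re
(z̄ c) = 0` for `c = 1` and `c = i`, so `z = 0`. -/

namespace TwistorCP3

open Topology ComplexConjugate VectorField

/-! ### The complex symplectic form of `ℂ⁴` -/

/-- The complex symplectic form `dz₀ ∧ dz₁ + dz₂ ∧ dz₃` on `ℂ⁴`. Its contraction with the position
vector is the complex contact form of `ℂP³`, whose kernel is the distribution `D₂⁴`. -/
noncomputable def symplectic : C4 →L[ℝ] C4 →L[ℝ] ℂ :=
  (LinearMap.mk₂ ℝ (fun v w : C4 => v 0 * w 1 - v 1 * w 0 + (v 2 * w 3 - v 3 * w 2))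
    (fun _ _ _ => by simp; ring) (fun _ _ _ => by simp; ring)
    (fun _ _ _ => by simp; ring) (fun _ _ _ => by simp; ring)).toContinuousBilinearMap

lemma symplectic_apply (v w : C4) :
    symplectic v w = v 0 * w 1 - v 1 * w 0 + (v 2 * w 3 - v 3 * w 2) := rfl

lemma symplectic_swap (v w : C4) : symplectic v w = -symplectic w v := by
  simp only [symplectic_apply]; ring

lemma symplectic_smul_left (c : ℂ) (v w : C4) : symplectic (c • v) w = c * symplectic v w := by
  simp only [symplectic_apply, PiLp.smul_apply, smul_eq_mul]; ring

lemma symplectic_smul_right (c : ℂ) (v w : C4) : symplectic v (c • w) = c * symplectic v w := by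
  simp only [symplectic_apply, PiLp.smul_apply, smul_eq_mul]; ring

lemma symplectic_self (v : C4) : symplectic v v = 0 := by
  simp only [symplectic_apply]; ring

/-- The bridge from the metric to the contact form: the conjugations in `j p` cancel the one in the
Hermitian product, leaving an expression complex bilinear in `p` and `w`. -/
lemma inner_jMul_left (p w : C4) : inner ℂ (jMul p) w = symplectic p w := by
  simp [PiLp.inner_apply, Fin.sum_univ_four, jMul, symplectic_apply]
  ring

lemma symplectic_jMul (p : C4) : symplectic p (jMul p) = inner ℂ p p := by
  rw [PiLp.inner_apply, Fin.sum_univ_four]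
  simp only [RCLike.inner_apply, symplectic_apply, jMul]
  simp
  ring

/-- The symplectic form does not vanish on the contact hyperplane of a point. -/
lemma exists_symplectic_ne_zero {p : C4} (hp : p ≠ 0) :
    ∃ v w : C4, symplectic p v = 0 ∧ symplectic p w = 0 ∧ symplectic v w ≠ 0 := by
  have h : p 0 ≠ 0 ∨ p 1 ≠ 0 ∨ p 2 ≠ 0 ∨ p 3 ≠ 0 := by
    by_contra! h
    refine hp ?_
    ext i
    fin_cases i
    exacts [h.1, h.2.1, h.2.2.1, h.2.2.2]
  rcases h with h | h | h | h
  -- The kernel of `ω(p, ·)` has complex dimension 3 and radical `ℂ p`, so such a pair exists. In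
  -- each case the witnesses are chosen so that `ω(v, w)` is the square of the non-zero coordinate.
  · refine ⟨!₂[0, p 3, p 0, 0], !₂[0, -p 2, 0, p 0], ?_, ?_, ?_⟩ <;>
      simp [symplectic_apply, h, mul_comm]
  · refine ⟨!₂[-p 3, 0, p 1, 0], !₂[p 2, 0, 0, p 1], ?_, ?_, ?_⟩ <;>
      simp [symplectic_apply, h, mul_comm]
  · refine ⟨!₂[p 2, 0, 0, p 1], !₂[0, p 2, 0, -p 0], ?_, ?_, ?_⟩ <;>
      simp [symplectic_apply, h, mul_comm]
  · refine ⟨!₂[p 3, 0, -p 1, 0], !₂[0, p 3, p 0, 0], ?_, ?_, ?_⟩ <;>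
      simp [symplectic_apply, h, mul_comm]

/-! ### The metrics `g_a` in terms of horizontal lifts -/

/-- The reflection differs from the identity by vectors of `liftD1 p`, which are themselves
horizontal. Hence `horLift` conjugates `P` to this reflection. -/
lemma reflection_mem_horizontal {p w : C4} (hw : w ∈ horizontal p) :
    (liftD1 p)ᗮ.reflection w ∈ horizontal p := by
  rw [Submodule.reflection_orthogonal_apply, Submodule.reflection_apply]
  refine neg_mem (sub_mem (nsmul_mem ?_ 2) hw)
  exact liftD1_le_horizontal p (Submodule.starProjection_apply_mem _ _)

lemma horLift_almostProduct (x : CP3) (u : TCP3 x) :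
    (horLift x (almostProduct x u) : C4) =
      (liftD1 (unitRep x))ᗮ.reflection (horLift x u : C4) :=
  horLift_dHopf x (reflection_mem_horizontal (horLift x u).2)

lemma fubiniStudy_comm (x : CP3) (u v : TCP3 x) : fubiniStudy x u v = fubiniStudy x v u :=
  real_inner_comm _ _

lemma fubiniStudy_almostProduct_left (x : CP3) (u v : TCP3 x) :
    fubiniStudy x (almostProduct x u) v = fubiniStudy x u (almostProduct x v) := by
  rw [fubiniStudy, fubiniStudy, horLift_almostProduct, horLift_almostProduct,
    ← LinearIsometryEquiv.inner_map_map (liftD1 (unitRep x))ᗮ.reflection (horLift x u : C4),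
    Submodule.reflection_reflection]

lemma metric_comm (a : ℝ) (x : CP3) (u v : TCP3 x) : metric a x u v = metric a x v u := by
  rw [metric, metric, fubiniStudy_comm x u, fubiniStudy_almostProduct_left, fubiniStudy_comm x u]

lemma fubiniStudy_neg_left (x : CP3) (u v : TCP3 x) :
    fubiniStudy x (-u) v = -fubiniStudy x u v := by
  rw [fubiniStudy, fubiniStudy, map_neg, Submodule.coe_neg, inner_neg_left]

/-- On `D₁²` all the metrics `g_a` agree. -/
lemma metric_of_mem_D1 (a : ℝ) {x : CP3} {N : TCP3 x} (hN : N ∈ D1 x) (u : TCP3 x) :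
    metric a x N u = fubiniStudy x N u := by
  rw [metric, almostProduct_of_mem_D1 hN, fubiniStudy_neg_left]; ring

lemma metric_add_right (a : ℝ) (x : CP3) (N u v : TCP3 x) :
    metric a x N (u + v) = metric a x N u + metric a x N v := by
  simp only [metric, fubiniStudy, map_add, Submodule.coe_add, inner_add_right]; ring

lemma metric_smul_right (a : ℝ) (x : CP3) (N : TCP3 x) (c : ℝ) (u : TCP3 x) :
    metric a x N (c • u) = c * metric a x N u := by
  simp only [metric, fubiniStudy, map_smul, Submodule.coe_smul, inner_smul_right]; ring

/-- The linear form `u ↦ g_a(N, u)`. -/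
noncomputable def metricForm (a : ℝ) (x : CP3) (N : TCP3 x) : TCP3 x →ₗ[ℝ] ℝ where
  toFun := metric a x N
  map_add' := metric_add_right a x N
  map_smul' := metric_smul_right a x N

lemma ne_zero_of_metric_self_eq_one {a : ℝ} {x : CP3} {N : TCP3 x} (hN : metric a x N N = 1) :
    N ≠ 0 := by
  rintro rfl
  exact zero_ne_one ((metricForm a x 0).map_zero.symm.trans hN)

/-- A `g_a`-unit vector of angle `π / 2` lies in `D₁²`. -/
lemma mem_D1_of_angle_eq {a : ℝ} (ha : 0 < a) {x : CP3} {N : TCP3 x}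
    (hN : metric a x N N = 1) (h : angle a x N = Real.pi / 2) : N ∈ D1 x := by
  -- `Real.arccos` is truncated outside `[-1, 1]`, so the value `π` only gives an inequality; that
  -- is enough.
  have h' : metric a x N (almostProduct x N) ≤ -1 := by
    rw [angle] at h
    exact Real.arccos_eq_pi.1 (by linarith)
  set K := liftD1 (unitRep x)
  set n : C4 := (horLift x N : C4) with hn
  have hPP : fubiniStudy x (almostProduct x N) (almostProduct x N) = fubiniStudy x N N := by
    rw [fubiniStudy, fubiniStudy, horLift_almostProduct]
    exact LinearIsometryEquiv.inner_map_map _ _ _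
  have e1 : fubiniStudy x (almostProduct x N) N = inner ℝ (Kᗮ.reflection n) n := by
    rw [fubiniStudy, horLift_almostProduct]
  have e2 : fubiniStudy x N N = inner ℝ n n := rfl
  rw [metric, hPP, ← fubiniStudy_almostProduct_left, e1, e2] at h'
  rw [metric, e1, e2] at hN
  -- Adding `hN` and `h'`, with `R` the reflection, gives `a (⟨R n, n⟩ + ⟨n, n⟩) ≤ 0`. The bracket
  -- is half of `‖R n + n‖²`, so `R n = -n`.
  have hle : inner ℝ (Kᗮ.reflection n) n + inner ℝ n n ≤ 0 := by nlinarith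
  have hsq : ‖Kᗮ.reflection n + n‖ ^ 2 ≤ 0 := by
    rw [norm_add_sq_real, LinearIsometryEquiv.norm_map, ← real_inner_self_eq_norm_sq]
    linarith
  have h0 : Kᗮ.reflection n + n = 0 :=
    norm_eq_zero.1 (pow_eq_zero_iff two_ne_zero |>.1 (le_antisymm hsq (sq_nonneg _)))
  rw [Submodule.reflection_orthogonal_apply, neg_add_eq_zero,
    Submodule.reflection_eq_self_iff] at h0
  exact ⟨n, h0, dHopf_horLift x N⟩

lemma exists_unitRep_eq_smul {p : C4} (hp : p ≠ 0) : ∃ c : ℂ, c ≠ 0 ∧ unitRep (proj p) = c • p := by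
  have h := proj_unitRep (proj p)
  rw [proj_of_ne (unitRep_ne _), proj_of_ne hp] at h
  obtain ⟨c, hc⟩ := (Projectivization.mk_eq_mk_iff' ℂ _ _ _ _).1 h
  rw [← proj_of_ne hp] at hc
  refine ⟨c, ?_, hc.symm⟩
  rintro rfl
  rw [zero_smul] at hc
  exact unitRep_ne _ hc.symm

lemma dHopf_unitRep_smul (x : CP3) (z : ℂ) : dHopf x (z • unitRep x) = 0 := by
  funext j
  refine (dproj_apply (unitRep_ne x) _ j).trans ?_
  have hi : unitRep x (chartIndex (proj (unitRep x))) ≠ 0 :=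
    (mem_affineChart_source (unitRep_ne x)).1 (mem_chartIndex_source _)
  simp only [PiLp.smul_apply, smul_eq_mul]
  change _ = (0 : ℂ)
  field_simp
  ring

/-- The `g_a`-pairing with a vector of `D₁²` factors through the contact form. -/
lemma exists_metric_eq_symplectic (a : ℝ) {p : C4} (hp : p ≠ 0) {x : CP3} (hx : proj p = x)
    {N : TCP3 x} (hN : N ∈ D1 x) (hN0 : N ≠ 0) :
    ∃ z : ℂ, z ≠ 0 ∧ ∀ w, metric a x N (dproj p w : Fin 3 → ℂ) = (conj z * symplectic p w).re := by
  subst hx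
  obtain ⟨c, hc, h⟩ := exists_unitRep_eq_smul hp
  obtain ⟨n, hn, rfl⟩ := id hN
  obtain ⟨z, rfl⟩ := mem_liftD1.1 hn
  -- Passing from `p` to the unit representative `c p` replaces `w` by `c w`, so bilinearity of `ω`
  -- produces `c²`, which is absorbed into the conjugated factor.
  refine ⟨z * conj c ^ 2, ?_, fun w => ?_⟩
  · refine mul_ne_zero ?_ (by simpa using hc)
    rintro rfl
    simp at hN0
  · rw [metric_of_mem_D1 a hN, ← dHopf_smul hp hc h]
    set q := unitRep (proj p) with hq
    have hqq : inner ℂ q q = 1 := by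
      rw [inner_self_eq_norm_sq_to_K, norm_unitRep]; simp
    -- `c w` need not be horizontal. Its component along `q` is removed: `dHopf` kills it, and so
    -- does `ω(q, ·)`.
    have hsplit : dHopf (proj p) (c • w) =
        dHopf (proj p) (c • w - inner ℂ q (c • w) • q) := by
      rw [map_sub, dHopf_unitRep_smul, sub_zero]
    rw [hsplit, fubiniStudy, horLift_dHopf _ (liftD1_le_horizontal _ hn), horLift_dHopf,
      inner_real_eq, inner_sub_right, inner_smul_left, inner_jMul_left, inner_smul_right,
      inner_smul_left, inner_jMul_left, symplectic_self, symplectic_smul_right, h,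
      symplectic_smul_left]
    · simp [pow_two]; ring
    · rw [mem_horizontal, inner_sub_right, inner_smul_right _ q, hqq, mul_one, sub_self]

/-! ### Line-valued pullbacks -/

/-- If the `1`-form `B(G, dG)` takes values in a real line of `ℂ` at each point, then so does
`B(dG, dG)` on the kernel of the form, with the same line. -/
lemma im_conj_mul_eq_zero_of_line_valued {E F : Type*} [NormedAddCommGroup E] [NormedSpace ℝ E]
    [NormedAddCommGroup F] [NormedSpace ℝ F] (B : F →L[ℝ] F →L[ℝ] ℂ)
    (hB : ∀ v w, B v w = -B w v) {G : E → F} {x : E} (hG : ContDiffAt ℝ 2 G x)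
    (hline : ∀ᶠ y in 𝓝 x, ∃ z : ℂ, z ≠ 0 ∧ ∀ v, (conj z * B (G y) (fderiv ℝ G y v)).re = 0)
    (e u v : E) (hu : B (G x) (fderiv ℝ G x u) = 0) (hv : B (G x) (fderiv ℝ G x v) = 0) :
    (conj (B (G x) (fderiv ℝ G x e)) * B (fderiv ℝ G x u) (fderiv ℝ G x v)).im = 0 := by
  set D := fderiv ℝ (fderiv ℝ G) x
  have hG1 : HasFDerivAt G (fderiv ℝ G x) x := (hG.differentiableAt two_ne_zero).hasFDerivAt
  have hG2 : HasFDerivAt (fderiv ℝ G) D x :=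
    ((hG.fderiv_right (m := 1) (by norm_num)).differentiableAt one_ne_zero).hasFDerivAt
  have hα : ∀ v, HasFDerivAt (fun y => B (G y) (fderiv ℝ G y v))
      (B.precompR E (G x) (D.flip v) + B.precompL E (fderiv ℝ G x) (fderiv ℝ G x v)) x := by
    intro v
    have h2 : HasFDerivAt (fun y => fderiv ℝ G y v) (D.flip v) x := by
      simpa using hG2.clm_apply (hasFDerivAt_const v x)
    exact B.hasFDerivAt_of_bilinear hG1 h2
  -- Writing `α` for the form `B(G, dG ·)`, this is the derivative of `Im (conj α(e) · α(v)) = 0` in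
  -- the direction `u`. As `α(v)` vanishes at `x`, only the second factor gets differentiated.
  have key : ∀ u v, B (G x) (fderiv ℝ G x v) = 0 →
      (conj (B (G x) (fderiv ℝ G x e)) *
        (B (G x) (D u v) + B (fderiv ℝ G x u) (fderiv ℝ G x v))).im = 0 := by
    intro u v hv
    have hφ : HasFDerivAt (fun y => (conj (B (G y) (fderiv ℝ G y e)) *
        B (G y) (fderiv ℝ G y v)).im) _ x :=
      Complex.imCLM.hasFDerivAt.comp x
        ((Complex.conjCLE.toContinuousLinearMap.hasFDerivAt.comp x (hα e)).mul (hα v))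
    have h0 : HasFDerivAt (fun y => (conj (B (G y) (fderiv ℝ G y e)) *
        B (G y) (fderiv ℝ G y v)).im) (0 : E →L[ℝ] ℝ) x := by
      refine (hasFDerivAt_const (0 : ℝ) x).congr_of_eventuallyEq ?_
      filter_upwards [hline] with y hy
      obtain ⟨z, hz, h⟩ := hy
      have h1 := h e
      have h2 := h v
      generalize B (G y) (fderiv ℝ G y e) = s at *
      generalize B (G y) (fderiv ℝ G y v) = t at *
      have hz' : 0 < z.re ^ 2 + z.im ^ 2 := by
        have := Complex.normSq_pos.2 hz
        rw [Complex.normSq_apply] at this; nlinarith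
      simp only [Complex.mul_re, Complex.mul_im, Complex.conj_re, Complex.conj_im] at *
      -- `s` and `t` are both real multiples of `i z`, so `s̄ t` is real; explicitly, `|z|² Im (s̄
      -- t)` is a combination of `Re (z̄ s)` and `Re (z̄ t)`.
      have : (z.re ^ 2 + z.im ^ 2) * (s.re * t.im + -s.im * t.re) = 0 := by
        linear_combination (z.re * t.im - z.im * t.re) * h1 + (z.im * s.re - z.re * s.im) * h2
      exact (mul_eq_zero.1 this).resolve_left hz'.ne'
    have := congrArg (fun L : E →L[ℝ] ℝ => L u) (hφ.unique h0)
    simp [hv] at this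
    simp
    linarith
  -- In the difference of `key u v` and `key v u` the symmetric second derivative cancels, while the
  -- alternating `B(dG u, dG v)` doubles.
  have hsymm : D u v = D v u := (hG.isSymmSndFDerivAt (by simp)) u v
  have h1 := key u v hv
  have h2 := key v u hu
  rw [hB (fderiv ℝ G x v), ← hsymm] at h2
  simp only [Complex.mul_im, Complex.add_re, Complex.add_im, Complex.neg_re, Complex.neg_im] at *
  linarith

/-! ### Affine lifts to `ℂ⁴` -/

lemma contDiff_affineSection_map (i : Fin 4) : ContDiff ℝ ∞ (affineSection i) :=
  (contDiff_piLp 2).2 (contDiff_affineSection i)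

lemma proj_affineSection_affineChart {i : Fin 4} {x : CP3} (hx : x ∈ (affineChart i).source) :
    proj (affineSection i (affineChart i x)) = x := by
  rw [← affineChart_symm, (affineChart i).left_inv hx]

lemma hasMFDerivAt_proj_comp {E : Type*} [NormedAddCommGroup E] [NormedSpace ℝ E] {G : E → C4}
    {e : E} (hG : DifferentiableAt ℝ G e) (h0 : G e ≠ 0) :
    HasMFDerivAt 𝓘(ℝ, E) 𝓘(ℝ, Fin 3 → ℂ) (proj ∘ G) e ((dproj (G e)).comp (fderiv ℝ G e)) :=
  (hasMFDerivAt_proj h0).mdifferentiableAt.hasMFDerivAt.comp e hG.hasFDerivAt.hasMFDerivAt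

lemma exists_smul_eq_of_dproj_eq_zero {p : C4} (hp : p ≠ 0) {w : C4} (h : dproj p w = 0) :
    ∃ c : ℂ, w = c • p := by
  have hi : p (chartIndex (proj p)) ≠ 0 :=
    (mem_affineChart_source hp).1 (mem_chartIndex_source _)
  refine ⟨w (chartIndex (proj p)) / p (chartIndex (proj p)), ?_⟩
  ext k
  refine Fin.succAboveCases (chartIndex (proj p)) ?_ (fun j => ?_) k
  · simp [hi]
  · have hj : (dproj p w : Fin 3 → ℂ) j = 0 := congrFun h j
    rw [dproj_apply hp] at hj
    simp only [PiLp.smul_apply, smul_eq_mul]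
    field_simp at hj ⊢
    linear_combination hj

/-! ### Hypersurfaces with unit normal in `D₁²` -/

section Hypersurface

variable {M : Type*} [TopologicalSpace M] [ChartedSpace (EuclideanSpace ℝ (Fin 5)) M] {f : M → CP3}

/-- In a chart, a smooth map to `ℂP³` lifts locally to a smooth map to `ℂ⁴ ∖ {0}`. -/
lemma exists_local_lift [IsManifold (𝓡 5) ∞ M] (hf : ContMDiff (𝓡 5) 𝓘(ℝ, Fin 3 → ℂ) ∞ f) (m : M) :
    ∃ G : EuclideanSpace ℝ (Fin 5) → C4,
      ContDiffAt ℝ 2 G (chartAt (EuclideanSpace ℝ (Fin 5)) m m) ∧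
      ∀ᶠ e in 𝓝 (chartAt (EuclideanSpace ℝ (Fin 5)) m m), G e ≠ 0 ∧
        proj (G e) = f ((chartAt (EuclideanSpace ℝ (Fin 5)) m).symm e) ∧
        ∀ v, (dproj (G e) (fderiv ℝ G e v) : Fin 3 → ℂ) =
          mfderiv (𝓡 5) 𝓘(ℝ, Fin 3 → ℂ) f ((chartAt (EuclideanSpace ℝ (Fin 5)) m).symm e)
            (mfderiv (𝓡 5) (𝓡 5) (chartAt (EuclideanSpace ℝ (Fin 5)) m).symm e v) := by
  set χ := chartAt (EuclideanSpace ℝ (Fin 5)) m with hχ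
  set i := chartIndex (f m)
  set h : EuclideanSpace ℝ (Fin 5) → CP3 := f ∘ χ.symm
  set G := affineSection i ∘ affineChart i ∘ h
  set O := χ.target ∩ h ⁻¹' (affineChart i).source with hO
  have hh : ContMDiffOn (𝓡 5) 𝓘(ℝ, Fin 3 → ℂ) ∞ h χ.target :=
    hf.comp_contMDiffOn (contMDiffOn_chart_symm (I := 𝓡 5) (x := m))
  have hOo : IsOpen O := hh.continuousOn.isOpen_inter_preimage χ.open_target (affineChart i).open_source
  have hm : χ m ∈ O := by
    refine ⟨χ.map_source (mem_chart_source _ m), ?_⟩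
    change f (χ.symm (χ m)) ∈ (affineChart i).source
    rw [χ.left_inv (mem_chart_source _ m)]
    exact mem_chartIndex_source (f m)
  have hGO : ContDiffOn ℝ ∞ G O := by
    refine (contDiff_affineSection_map i).comp_contDiffOn ?_
    rw [← contMDiffOn_iff_contDiffOn]
    exact (contMDiffOn_chart (I := 𝓘(ℝ, Fin 3 → ℂ)) (n := ∞) (x := f m)).comp
      (hh.mono Set.inter_subset_left) fun e he => he.2
  refine ⟨G, (hGO.contDiffAt (hOo.mem_nhds hm)).of_le (by norm_cast), ?_⟩
  have hproj : ∀ e ∈ O, proj (G e) = h e := fun e he => proj_affineSection_affineChart he.2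
  filter_upwards [hOo.mem_nhds hm] with e he
  have hG0 : G e ≠ 0 := affineSection_ne _ _
  refine ⟨hG0, hproj e he, fun v => ?_⟩
  -- Near `e` the maps `proj ∘ G` and `f ∘ χ⁻¹` coincide; the chain rule for each, with uniqueness
  -- of the derivative, gives the claim.
  have h1 := (hasMFDerivAt_proj_comp ((hGO.contDiffAt (hOo.mem_nhds he)).differentiableAt
    (by simp)) hG0).congr_of_eventuallyEq (f₁ := h)
    (by filter_upwards [hOo.mem_nhds he] with y hy using (hproj y hy).symm)
  have h2 := ((hf.mdifferentiableAt (by simp)).hasMFDerivAt).comp e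
    ((mdifferentiableAt_atlas_symm (I := 𝓡 5) (chart_mem_atlas _ m) he.1).hasMFDerivAt)
  have h3 := hasMFDerivAt_unique h1 h2
  exact congrArg (fun L : EuclideanSpace ℝ (Fin 5) →L[ℝ] (Fin 3 → ℂ) => L v) h3

/-- The tangent space of a hypersurface is the orthogonal complement of its unit normal. -/
lemma exists_mfderiv_eq_of_metric_eq_zero {a : ℝ} (hf : IsHypersurface f) {m : M} {N : TCP3 (f m)}
    (hN : IsUnitNormal a f m N) {u : TCP3 (f m)} (hu : metric a (f m) N u = 0) :
    ∃ v, mfderiv (𝓡 5) 𝓘(ℝ, Fin 3 → ℂ) f m v = u := by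
  let L : EuclideanSpace ℝ (Fin 5) →ₗ[ℝ] (Fin 3 → ℂ) :=
    (mfderiv (𝓡 5) 𝓘(ℝ, Fin 3 → ℂ) f m).toLinearMap
  let φ : (Fin 3 → ℂ) →ₗ[ℝ] ℝ := metricForm a (f m) N
  have hle : L.range ≤ φ.ker := by
    rintro _ ⟨v, rfl⟩
    exact hN.2 v
  -- Both spaces have real dimension 5: one by injectivity of the differential, the other as the
  -- kernel of a non-zero form on a 6-dimensional space.
  have hrange : Module.finrank ℝ L.range = 5 := by
    rw [LinearMap.finrank_range_of_inj (f := L) (hf.2 m)]; simp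
  have hφ : φ ≠ 0 := fun h => by
    have h1 : φ N = 1 := hN.1
    rw [h] at h1
    exact zero_ne_one h1
  have hker : Module.finrank ℝ φ.ker = 5 := by
    have h1 := φ.finrank_range_add_finrank_ker
    have h2 : Module.finrank ℝ (Fin 3 → ℂ) = 6 := by
      rw [Module.finrank_pi_fintype]; simp [Complex.finrank_real_complex]
    rw [LinearMap.range_eq_top.2 (LinearMap.surjective hφ), finrank_top, h2,
      Module.finrank_self] at h1
    omega
  have heq := Submodule.eq_of_le_of_finrank_eq hle (hrange.trans hker.symm)
  have : u ∈ L.range := by rw [heq]; exact hu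
  exact this

/-- No hypersurface has its unit normal in `D₁²` at every point. -/
lemma not_forall_isUnitNormal_mem_D1 [IsManifold (𝓡 5) ∞ M] [Nonempty M] (a : ℝ)
    (hf : IsHypersurface f) :
    ¬ ∃ N : ∀ m : M, TCP3 (f m), ∀ m, IsUnitNormal a f m (N m) ∧ N m ∈ D1 (f m) := by
  rintro ⟨N, hN⟩
  obtain ⟨m⟩ := ‹Nonempty M›
  have hN0 : ∀ m, N m ≠ 0 := fun m => ne_zero_of_metric_self_eq_one (hN m).1.1
  obtain ⟨G, hG, hev⟩ := exists_local_lift hf.1 m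
  set χ := chartAt (EuclideanSpace ℝ (Fin 5)) m
  have hline : ∀ᶠ e in 𝓝 (χ m), ∃ z : ℂ, z ≠ 0 ∧
      ∀ v, (conj z * symplectic (G e) (fderiv ℝ G e v)).re = 0 := by
    filter_upwards [hev] with e he
    obtain ⟨z, hz, h⟩ := exists_metric_eq_symplectic a he.1 he.2.1 (hN _).2 (hN0 _)
    refine ⟨z, hz, fun v => ?_⟩
    rw [← h, he.2.2 v]
    exact (hN _).1.2 _
  obtain ⟨hp, hpx, hd⟩ := hev.self_of_nhds
  set p := G (χ m)
  obtain ⟨z, hz, hmet⟩ := exists_metric_eq_symplectic a hp hpx (hN _).2 (hN0 _)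
  -- The image of `dG` is known only modulo `ℂ p`, the kernel of `dπ_p`. The ambiguity is harmless
  -- because `ω(p, p) = 0`.
  have hsurj : ∀ w : C4, (conj z * symplectic p w).re = 0 →
      ∃ (v : EuclideanSpace ℝ (Fin 5)) (c : ℂ), fderiv ℝ G (χ m) v = w + c • p := by
    intro w hw
    rw [← hmet] at hw
    obtain ⟨t, ht⟩ := exists_mfderiv_eq_of_metric_eq_zero hf (hN _).1 hw
    obtain ⟨v, hv⟩ := ((mdifferentiable_chart (I := 𝓡 5) m).symm).mfderiv_surjective
      (χ.map_source (mem_chart_source _ m)) t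
    rw [← hv] at ht
    have h0 := (hd v).trans ht
    obtain ⟨c, hc⟩ := exists_smul_eq_of_dproj_eq_zero hp (w := fderiv ℝ G (χ m) v - w) (by
      rw [map_sub]; exact sub_eq_zero.2 h0)
    exact ⟨v, c, by rw [← hc]; abel⟩
  -- A tangent direction outside `D₂⁴`: `ω(p, i z · j p) = i z |p|²` is non-zero and lies on the
  -- line `Re (z̄ ·) = 0`. It fixes the real line in which the values of `ω` must lie.
  obtain ⟨e, ce, he⟩ := hsurj ((Complex.I * z) • jMul p) (by
    rw [symplectic_smul_right, symplectic_jMul, inner_self_eq_norm_sq_to_K]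
    simp [pow_two]
    ring)
  have hc : symplectic p (fderiv ℝ G (χ m) e) ≠ 0 := by
    rw [he, map_add, symplectic_smul_right, symplectic_smul_right, symplectic_self, mul_zero,
      add_zero, symplectic_jMul]
    exact mul_ne_zero (mul_ne_zero Complex.I_ne_zero hz) (inner_self_ne_zero.2 hp)
  set c := symplectic p (fderiv ℝ G (χ m) e) with hcdef
  have hreal : ∀ v w, symplectic p v = 0 → symplectic p w = 0 →
      (conj c * symplectic v w).im = 0 := by
    intro v w hv hw
    obtain ⟨v', b, hv'⟩ := hsurj v (by simp [hv])
    obtain ⟨w', d, hw'⟩ := hsurj w (by simp [hw])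
    have h := im_conj_mul_eq_zero_of_line_valued symplectic symplectic_swap hG hline e v' w'
      (by rw [hv', map_add, symplectic_smul_right, symplectic_self, hv, mul_zero, add_zero])
      (by rw [hw', map_add, symplectic_smul_right, symplectic_self, hw, mul_zero, add_zero])
    rw [hv', hw'] at h
    simpa only [map_add, add_apply, symplectic_smul_left,
      symplectic_smul_right, symplectic_self, symplectic_swap v p, hv, hw, mul_zero, add_zero,
      neg_zero] using h
  obtain ⟨v, w, hv, hw, hvw⟩ := exists_symplectic_ne_zero hp
  have h1 := hreal v w hv hw
  -- The kernel of `ω(p, ·)` is complex, so `v` may be replaced by `i v`; this kills the real part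
  -- as well.
  have h2 := hreal (Complex.I • v) w (by rw [symplectic_smul_right, hv, mul_zero]) hw
  rw [symplectic_smul_left, mul_left_comm, Complex.I_mul_im] at h2
  have h3 : conj c * symplectic v w = 0 := Complex.ext h2 h1
  exact mul_ne_zero (by simpa using hc) hvw h3

end Hypersurface

/-! ### Sections of the contact distribution in an affine chart -/

/-- The chart vector field `c (∂₂ + w₃ ∂₁)`, in coordinates `(w₁, w₂, w₃)` on `{z₀ ≠ 0}`. -/
noncomputable def contactFieldLeft (c : ℂ) (w : Fin 3 → ℂ) : Fin 3 → ℂ := ![c * w 2, c, 0]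

/-- The chart vector field `∂₃ - w₂ ∂₁`, in coordinates `(w₁, w₂, w₃)` on `{z₀ ≠ 0}`. -/
noncomputable def contactFieldRight (w : Fin 3 → ℂ) : Fin 3 → ℂ := ![-w 1, 0, 1]

lemma contDiff_contactFieldLeft (c : ℂ) : ContDiff ℝ ∞ (contactFieldLeft c) := by
  refine contDiff_pi.2 fun k => ?_
  fin_cases k <;> simp [contactFieldLeft] <;> fun_prop

lemma contDiff_contactFieldRight : ContDiff ℝ ∞ contactFieldRight := by
  refine contDiff_pi.2 fun k => ?_
  fin_cases k <;> simp [contactFieldRight] <;> fun_prop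

/-- The bracket is a multiple of `∂₁`, on which the contact form equals 1, so it leaves the kernel
of that form when `c ≠ 0`. Each of the two differentiated coefficients contributes `-c`. -/
lemma lieBracket_contactField (c : ℂ) (w : Fin 3 → ℂ) :
    lieBracket ℝ (contactFieldLeft c) contactFieldRight w = ![-2 * c, 0, 0] := by
  have hL : HasFDerivAt (contactFieldLeft c) (ContinuousLinearMap.pi
      ![c • (ContinuousLinearMap.proj 2 : (Fin 3 → ℂ) →L[ℝ] ℂ), 0, 0]) w := by
    refine hasFDerivAt_pi.2 fun k => ?_
    fin_cases k
    · exact ((ContinuousLinearMap.proj 2 : (Fin 3 → ℂ) →L[ℝ] ℂ).hasFDerivAt).const_mul c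
    · exact hasFDerivAt_const _ _
    · exact hasFDerivAt_const _ _
  have hR : HasFDerivAt contactFieldRight (ContinuousLinearMap.pi
      ![-(ContinuousLinearMap.proj 1 : (Fin 3 → ℂ) →L[ℝ] ℂ), 0, 0]) w := by
    refine hasFDerivAt_pi.2 fun k => ?_
    fin_cases k
    · exact ((ContinuousLinearMap.proj 1 : (Fin 3 → ℂ) →L[ℝ] ℂ).hasFDerivAt).neg
    · exact hasFDerivAt_const _ _
    · exact hasFDerivAt_const _ _
  rw [lieBracket, hL.fderiv, hR.fderiv]
  funext k
  fin_cases k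
  · simp [contactFieldLeft, contactFieldRight]; ring
  · simp
  · simp

/-- The vector field on `{z₀ ≠ 0} ⊆ ℂP³` with chart expression `X`. -/
noncomputable def chartField (X : (Fin 3 → ℂ) → (Fin 3 → ℂ)) (x : CP3) : TCP3 x :=
  mpullback 𝓘(ℝ, Fin 3 → ℂ) 𝓘(ℝ, Fin 3 → ℂ) (affineChart 0) X x

lemma affineChart_mdifferentiable (i : Fin 4) :
    (affineChart i).MDifferentiable 𝓘(ℝ, Fin 3 → ℂ) 𝓘(ℝ, Fin 3 → ℂ) :=
  mdifferentiable_of_mem_atlas (Set.mem_range_self i)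

lemma contMDiffAt_affineChart {i : Fin 4} {x : CP3} (hx : x ∈ (affineChart i).source) :
    ContMDiffAt 𝓘(ℝ, Fin 3 → ℂ) 𝓘(ℝ, Fin 3 → ℂ) ∞ (affineChart i) x :=
  (contMDiffOn_of_mem_maximalAtlas (IsManifold.subset_maximalAtlas (Set.mem_range_self i))).contMDiffAt
    ((affineChart i).open_source.mem_nhds hx)

lemma isInvertible_mfderiv_affineChart {i : Fin 4} {x : CP3} (hx : x ∈ (affineChart i).source) :
    (mfderiv 𝓘(ℝ, Fin 3 → ℂ) 𝓘(ℝ, Fin 3 → ℂ) (affineChart i) x).IsInvertible :=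
  ⟨(affineChart_mdifferentiable i).mfderiv hx, rfl⟩

lemma isSmoothFieldOn_chartField {X : (Fin 3 → ℂ) → (Fin 3 → ℂ)} (hX : ContDiff ℝ ∞ X) :
    IsSmoothFieldOn (chartField X) (affineChart 0).source := fun x hx =>
  (ContMDiffAt.mpullback_vectorField_preimage (n := ∞)
    (contMDiffAt_vectorSpace_iff_contDiffAt.2 hX.contDiffAt)
    (contMDiffAt_affineChart hx) (isInvertible_mfderiv_affineChart hx) (by simp)).contMDiffWithinAt

/-- Brackets commute with pullback under a local diffeomorphism, which reduces the computation to
`ℂ³`. -/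
lemma mlieBracket_chartField {X Y : (Fin 3 → ℂ) → (Fin 3 → ℂ)} (hX : ContDiff ℝ ∞ X)
    (hY : ContDiff ℝ ∞ Y) {x : CP3} (hx : x ∈ (affineChart 0).source) :
    mlieBracket 𝓘(ℝ, Fin 3 → ℂ) (chartField X) (chartField Y) x =
      chartField (lieBracket ℝ X Y) x := by
  have : IsManifold 𝓘(ℝ, Fin 3 → ℂ) (minSmoothness ℝ 2) CP3 :=
    IsManifold.of_le (n := ∞) (by rw [minSmoothness_of_isRCLikeNormedField]; norm_cast)
  have h := mpullback_mlieBracket (n := ∞) (f := affineChart 0) (x₀ := x)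
    (I := 𝓘(ℝ, Fin 3 → ℂ)) (I' := 𝓘(ℝ, Fin 3 → ℂ)) (V := X) (W := Y)
    ((contMDiffAt_vectorSpace_iff_contDiffAt.2 hX.contDiffAt).mdifferentiableAt (by simp))
    ((contMDiffAt_vectorSpace_iff_contDiffAt.2 hY.contDiffAt).mdifferentiableAt (by simp))
    (contMDiffAt_affineChart hx)
    (by rw [minSmoothness_of_isRCLikeNormedField]; norm_cast)
  have hXY : mlieBracket 𝓘(ℝ, Fin 3 → ℂ) X Y = lieBracket ℝ X Y :=
    mlieBracketWithin_univ.symm.trans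
      (mlieBracketWithin_eq_lieBracketWithin.trans lieBracketWithin_univ)
  exact h.symm.trans (congrArg (fun Z => chartField Z x) hXY)

lemma fderiv_affineSection_apply (w v : Fin 3 → ℂ) :
    fderiv ℝ (affineSection 0) w v = !₂[0, v 0, v 1, v 2] := by
  let T : (Fin 3 → ℂ) →L[ℝ] C4 :=
    ((PiLp.continuousLinearEquiv 2 ℝ (fun _ : Fin 4 => ℂ)).symm :
      (Fin 4 → ℂ) →L[ℝ] C4) ∘L ContinuousLinearMap.pi
        ![0, ContinuousLinearMap.proj 0, ContinuousLinearMap.proj 1, ContinuousLinearMap.proj 2]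
  have hT : ∀ v, T v = !₂[0, v 0, v 1, v 2] := fun v => by
    ext k; fin_cases k <;> simp [T]
  have h : affineSection 0 = fun w => EuclideanSpace.single 0 1 + T w := by
    funext w
    ext k
    rw [hT]
    fin_cases k <;> simp [affineSection] <;> rfl
  rw [h, fderiv_const_add, T.fderiv, hT]

/-- `proj ∘ affineSection 0` inverts the chart, so the pulled-back field is `dπ` applied to a vector
at an explicit lift. In this form `exists_metric_eq_symplectic` applies to it. -/
lemma chartField_eq (X : (Fin 3 → ℂ) → (Fin 3 → ℂ)) {x : CP3} (hx : x ∈ (affineChart 0).source) :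
    (chartField X x : Fin 3 → ℂ) = (dproj (affineSection 0 (affineChart 0 x))
      (fderiv ℝ (affineSection 0) (affineChart 0 x) (X (affineChart 0 x))) : Fin 3 → ℂ) := by
  set w := affineChart 0 x with hw
  have hx' : proj (affineSection 0 w) = x := proj_affineSection_affineChart hx
  have h1 := hasMFDerivAt_proj_comp (((contDiff_affineSection_map 0).differentiable (by simp)) w)
    (affineSection_ne 0 w)
  have h2 : HasMFDerivAt 𝓘(ℝ, Fin 3 → ℂ) 𝓘(ℝ, Fin 3 → ℂ) (affineChart 0)
      ((proj ∘ affineSection 0) w)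
      (mfderiv 𝓘(ℝ, Fin 3 → ℂ) 𝓘(ℝ, Fin 3 → ℂ) (affineChart 0) (proj (affineSection 0 w))) := by
    refine MDifferentiableAt.hasMFDerivAt ?_
    refine (affineChart_mdifferentiable 0).mdifferentiableAt ?_
    rw [Function.comp_apply, hx']; exact hx
  have h3 := (h2.comp w h1).congr_of_eventuallyEq (f₁ := id) (Filter.Eventually.of_forall fun y => by
    simp only [Function.comp_apply, ← affineChart_symm]
    exact ((affineChart 0).right_inv (Set.mem_univ y)).symm)
  have h4 := hasMFDerivAt_unique h3 (hasMFDerivAt_id w)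
  have h5 := congrArg (fun L : (Fin 3 → ℂ) →L[ℝ] (Fin 3 → ℂ) => L (X w)) h4
  rw [hx'] at h5
  obtain ⟨L, hL⟩ := isInvertible_mfderiv_affineChart hx
  change (mfderiv 𝓘(ℝ, Fin 3 → ℂ) 𝓘(ℝ, Fin 3 → ℂ) (affineChart 0) x).inverse (X w) = _
  rw [← hL, ContinuousLinearMap.inverse_equiv]
  rw [← hL] at h5
  exact L.symm_apply_eq.2 h5.symm

/-- The hyperplane `{z₀ = 0}` has empty interior: adding a small real `t ≠ 0` to the zeroth
coordinate leaves it. -/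
lemma exists_mem_affineChart_zero {U : Set CP3} (hU : IsOpen U) (hne : U.Nonempty) :
    ∃ x ∈ U, x ∈ (affineChart 0).source := by
  obtain ⟨x, hx⟩ := hne
  by_cases h0 : unitRep x 0 = 0
  swap
  · exact ⟨x, hx, by
      rw [← proj_unitRep x]; exact (mem_affineChart_source (unitRep_ne x)).2 h0⟩
  have hc : Filter.Tendsto (fun t : ℝ => proj (unitRep x + t • EuclideanSpace.single 0 (1 : ℂ)))
      (𝓝[≠] 0) (𝓝 x) := by
    have h1 : ContinuousAt (fun t : ℝ => unitRep x + t • (EuclideanSpace.single 0 (1 : ℂ) : C4)) 0 :=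
      by fun_prop
    have h2 := (ContinuousAt.comp (f := fun t : ℝ => unitRep x +
      t • (EuclideanSpace.single 0 (1 : ℂ) : C4)) (g := proj) (x := 0)
      (by simpa using continuousAt_proj (unitRep_ne x)) h1).tendsto
    simp only [Function.comp_apply, zero_smul, add_zero, proj_unitRep] at h2
    exact h2.mono_left nhdsWithin_le_nhds
  obtain ⟨t, htU, ht⟩ := ((hc.eventually (hU.mem_nhds hx)).and self_mem_nhdsWithin).exists
  have hne : (unitRep x + t • (EuclideanSpace.single 0 (1 : ℂ) : C4)) 0 ≠ 0 := by
    simpa [h0] using ht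
  exact ⟨_, htU, (mem_affineChart_source (ne_of_coord_ne hne)).2 hne⟩

/-- The contact form in the chart; the two contact fields are chosen to lie in its kernel. -/
lemma symplectic_affineSection (w v : Fin 3 → ℂ) :
    symplectic (affineSection 0 w) (fderiv ℝ (affineSection 0) w v) =
      v 0 + (w 1 * v 2 - w 2 * v 1) := by
  rw [fderiv_affineSection_apply, symplectic_apply]
  simp [affineSection]
  rfl

/-- The orthogonal complement of a unit field in `D₁²` is nowhere involutive. -/
lemma not_isInvolutiveOn_orthogonalDistribution (a : ℝ) {U : Set CP3} {N : ∀ x : CP3, TCP3 x}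
    (hU : IsOpen U) (hne : U.Nonempty)
    (hN : ∀ x ∈ U, metric a x (N x) (N x) = 1 ∧ N x ∈ D1 x) :
    ¬ IsInvolutiveOn (orthogonalDistribution a N) U := by
  intro hinv
  obtain ⟨x, hxU, hx⟩ := exists_mem_affineChart_zero hU hne
  have hform : ∀ y ∈ U ∩ (affineChart 0).source, ∃ z : ℂ, z ≠ 0 ∧ ∀ X,
      chartField X y ∈ orthogonalDistribution a N y ↔
      (conj z * (X (affineChart 0 y) 0 + (affineChart 0 y 1 * X (affineChart 0 y) 2 -
        affineChart 0 y 2 * X (affineChart 0 y) 1))).re = 0 := by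
    rintro y ⟨hyU, hy⟩
    obtain ⟨z, hz, h⟩ := exists_metric_eq_symplectic a (affineSection_ne 0 (affineChart 0 y))
      (proj_affineSection_affineChart hy) (hN y hyU).2
      (ne_zero_of_metric_self_eq_one (hN y hyU).1)
    refine ⟨z, hz, fun X => ?_⟩
    rw [← symplectic_affineSection, ← h, ← chartField_eq X hy]
    change metric a y _ _ = 0 ↔ _
    rw [metric_comm]
  have hVo : IsOpen (U ∩ (affineChart 0).source) := hU.inter (affineChart 0).open_source
  -- Both contact fields are sections of `D₂⁴`, hence orthogonal to `N` for any factor `z`;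
  -- involutivity then puts their bracket in the complement.
  have key : ∀ c : ℂ, chartField (fun _ => ![-2 * c, 0, 0]) x ∈ orthogonalDistribution a N x := by
    intro c
    have h := hinv _ Set.inter_subset_left hVo (chartField (contactFieldLeft c))
      (chartField contactFieldRight)
      ((isSmoothFieldOn_chartField (contDiff_contactFieldLeft c)).mono Set.inter_subset_right)
      ((isSmoothFieldOn_chartField contDiff_contactFieldRight).mono Set.inter_subset_right)
      (fun y hy => by
        obtain ⟨z, -, h⟩ := hform y hy
        rw [h]; simp [contactFieldLeft, mul_comm])
      (fun y hy => by
        obtain ⟨z, -, h⟩ := hform y hy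
        rw [h]; simp [contactFieldRight]) x ⟨hxU, hx⟩
    rw [mlieBracket_chartField (contDiff_contactFieldLeft c) contDiff_contactFieldRight hx,
      show lieBracket ℝ (contactFieldLeft c) contactFieldRight = fun _ => ![-2 * c, 0, 0] from
        funext (lieBracket_contactField c)] at h
    exact h
  obtain ⟨z, hz, h⟩ := hform x ⟨hxU, hx⟩
  -- The values `c = 1` and `c = i` give the vanishing of the real and imaginary parts of `z`.
  have h1 := (h _).1 (key 1)
  have h2 := (h _).1 (key Complex.I)
  refine hz (Complex.ext ?_ ?_)
  · simpa using h1
  · simpa using h2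

end TwistorCP3

theorem mainTheorem7 (a : ℝ) (ha : 0 < a) :
    (∀ (M : Type*) [TopologicalSpace M] [ChartedSpace (EuclideanSpace ℝ (Fin 5)) M]
        [IsManifold (𝓡 5) ∞ M] [Nonempty M] (f : M → CP3), IsHypersurface f →
      ¬ IsVertical a f ∧
      ¬ ∃ N : ∀ m : M, TCP3 (f m), ∀ m, IsUnitNormal a f m (N m) ∧ N m ∈ D1 (f m)) ∧
    (∀ (U : Set CP3) (N : ∀ x : CP3, TCP3 x), IsOpen U → U.Nonempty → IsSmoothFieldOn N U →
      (∀ x ∈ U, metric a x (N x) (N x) = 1 ∧ N x ∈ D1 x) →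
      ¬ IsInvolutiveOn (orthogonalDistribution a N) U) := by
  refine ⟨fun M _ _ _ _ f hf => ⟨?_, not_forall_isUnitNormal_mem_D1 a hf⟩,
    fun U N hU hne _ hN => not_isInvolutiveOn_orthogonalDistribution a hU hne hN⟩
  rintro ⟨N, hN⟩
  exact not_forall_isUnitNormal_mem_D1 a hf
    ⟨N, fun m => ⟨(hN m).1, mem_D1_of_angle_eq ha (hN m).1.1 (hN m).2⟩⟩
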